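/- Let $\mathcal{X}$ be a finite set and let $\mathcal{M}$ be a finite set of 3-element subsets of $\mathcal{X}$ such that every element of $\mathcal{X}$ belongs to at least one member of $\mathcal{M}$. An exact cover (a solution of the instance $I=(\mathcal{X},\mathcal{M})$ of Exact Cover by 3-Sets) is a subcollection $\mathcal{R}\subseteq\mathcal{M}$ such that each element of $\mathcal{X}$ is contained in exactly one member of $\mathcal{R}$. Put $r:=3|\mathcal{M}|$ and let $G$ be the following simple graph. For each $M\in\mathcal{M}$ it contains a clique $C(M)$ on $r^2$ vertices, and in addition it contains a clique on $|\mathcal{X}|$ vertices $v(x)$, $x\in\mathcal{X}$; all these cliques are vertex-disjoint. There are no edges between $C(M)$ and $C(M')$ for $M\neq M'$, and $v(x)$ is joined to every vertex of $C(M)$ if $x\in M$ and to none of them if $x\notin M$. Let $m$ be the number of edges of $G$, let $n=|\mathcal{M}|\cdot r^2+|\mathcal{X}|$ be its number of vertices, and $p=\binom{n}{2}$. A clustering $\zeta$ of $G$ is a partition of its vertex set into nonempty clusters. Let $i_p(\zeta)=\sum_{C\in\zeta}\binom{|C|}{2}$ be the number of vertex pairs within clusters, let $i_e(\zeta)$ be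 the number of edges of $G$ with both endpoints in the same cluster, and define the surprise of $\zeta$ by $$S(\zeta)=\sum_{i=i_e(\zeta)}^{m}\frac{\binom{i_p(\zeta)}{i}\binom{p-i_p(\zeta)}{m-i}}{\binom{p}{m}},$$ where $\binom{a}{b}=0$ for $b>a$. Then there is a constant $c>0$, independent of the instance, such that for all such instances $(\mathcal{X},\mathcal{M})$ with $r\ge c$ the following holds: $(\mathcal{X},\mathcal{M})$ has an exact cover if and only if there exists a clustering $\zeta$ of $G$ with $$S(\zeta)\;\le\; k:=\binom{p}{m}^{-1}\cdot\binom{\binom{|\mathcal{M}|\cdot r^2+|\mathcal{X}|}{2}-|\mathcal{M}|\cdot\binom{r^2}{2}-|\mathcal{X}|\cdot r^2-|\mathcal{X}|}{(3|\mathcal{M}|-|\mathcal{X}|)\cdot r^2+\binom{|\mathcal{X}|}{2}-|\mathcal{X}|}.$$ -/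

import Mathlib

namespace SurpriseClustering

/-! ### Surprise of a clustering -/

section Surprise

variable {V : Type*} [Fintype V] [DecidableEq V]

/-- A clustering of a graph on `V` is a partition of `V` into nonempty clusters. -/
abbrev Clustering (V : Type*) [Fintype V] [DecidableEq V] : Type _ :=
  Finpartition (Finset.univ : Finset V)

/-- The number of vertex pairs of a graph on `V`. -/
def numPairs (V : Type*) [Fintype V] : ℕ := (Fintype.card V).choose 2

/-- The number of edges of `G`. -/
def numEdges (G : SimpleGraph V) [DecidableRel G.Adj] : ℕ := G.edgeFinset.card

/-- The number of vertex pairs inside the clusters of `ζ`. -/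
def intraPairs (ζ : Clustering V) : ℕ := ∑ C ∈ ζ.parts, C.card.choose 2

/-- The number of edges of `G` that have both endpoints in `C`. -/
def edgesWithin (G : SimpleGraph V) [DecidableRel G.Adj] (C : Finset V) : ℕ :=
  (G.edgeFinset.filter fun e => e ∈ C.sym2).card

/-- The number of intracluster edges of `ζ`. -/
def intraEdges (G : SimpleGraph V) [DecidableRel G.Adj] (ζ : Clustering V) : ℕ :=
  ∑ C ∈ ζ.parts, edgesWithin G C

/-- The surprise of the clustering `ζ` of `G`: the hypergeometric tail
`∑ i = i_e, …, m, (i_p choose i) * (p - i_p choose m - i) / (p choose m)`. -/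
noncomputable def surprise (G : SimpleGraph V) [DecidableRel G.Adj] (ζ : Clustering V) : ℝ :=
  ∑ i ∈ Finset.Icc (intraEdges G ζ) (numEdges G),
    (((intraPairs ζ).choose i : ℝ) *
        ((numPairs V - intraPairs ζ).choose (numEdges G - i) : ℝ)) /
      ((numPairs V).choose (numEdges G) : ℝ)

end Surprise

/-! ### Exact cover by 3-sets and the reduction -/

section Reduction

variable {X : Type*} [DecidableEq X]

/-- Some subcollection `R` of `M` contains each element of `X` in exactly one of its members. -/
def HasExactCover (M : Finset (Finset X)) : Prop :=
  ∃ R : Finset (Finset X), R ⊆ M ∧ ∀ x : X, ∃! S : Finset X, S ∈ R ∧ x ∈ S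

/-- The parameter `r = 3 |M|`. -/
def param (M : Finset (Finset X)) : ℕ := 3 * M.card

/-- Vertices of the constructed graph: one vertex for every element of `X`, and `r ^ 2` vertices
for every set in `M`. -/
abbrev RedVertex (M : Finset (Finset X)) : Type _ :=
  X ⊕ ({S : Finset X // S ∈ M} × Fin (param M ^ 2))

/-- Adjacency in the constructed graph: the element vertices form a clique, the vertices of each
set in `M` form a clique, and an element is linked to all clique vertices of each set that
contains it. -/
def redAdj (M : Finset (Finset X)) : RedVertex M → RedVertex M → Prop
  | .inl x, .inl y => x ≠ y
  | .inl x, .inr (S, _) => x ∈ S.1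
  | .inr (S, _), .inl x => x ∈ S.1
  | .inr (S, i), .inr (T, j) => S = T ∧ i ≠ j

instance redAdjDecidable (M : Finset (Finset X)) : DecidableRel (redAdj M)
  | .inl x, .inl y => inferInstanceAs (Decidable (x ≠ y))
  | .inl x, .inr (S, _) => inferInstanceAs (Decidable (x ∈ S.1))
  | .inr (S, _), .inl x => inferInstanceAs (Decidable (x ∈ S.1))
  | .inr (S, i), .inr (T, j) => inferInstanceAs (Decidable (S = T ∧ i ≠ j))

/-- The graph constructed from the instance `(X, M)`. -/
def redGraph (M : Finset (Finset X)) : SimpleGraph (RedVertex M) where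
  Adj := redAdj M
  symm := ⟨by
    rintro (x | ⟨S, i⟩) (y | ⟨T, j⟩) h
    · exact Ne.symm h
    · exact h
    · exact h
    · exact ⟨h.1.symm, h.2.symm⟩⟩
  loopless := ⟨by
    rintro (x | ⟨S, i⟩) h
    · exact h rfl
    · exact h.2 rfl⟩

instance redGraphDecidable (M : Finset (Finset X)) : DecidableRel (redGraph M).Adj :=
  redAdjDecidable M

/-- The threshold `k`. If `M` is nonempty and its members are 3-element sets that cover `X`, then
`3 ≤ |X| ≤ 3 |M|`, and none of the subtractions below truncates. -/
noncomputable def threshold [Fintype X] (M : Finset (Finset X)) : ℝ :=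
  ((numPairs (RedVertex M)).choose (numEdges (redGraph M)) : ℝ)⁻¹ *
    (((M.card * param M ^ 2 + Fintype.card X).choose 2 - M.card * (param M ^ 2).choose 2
        - Fintype.card X * param M ^ 2 - Fintype.card X).choose
      ((3 * M.card - Fintype.card X) * param M ^ 2 + (Fintype.card X).choose 2
        - Fintype.card X) : ℝ)

end Reduction

end SurpriseClustering

/-! Write `e` and `a` for the intracluster edges and pairs, and `A` for `coverPairs M`. Up to the
common factor `1 / (p choose m)`, surprise is `tailCount`, and the threshold is `(p - A).choose (m -
A)`.

An exact cover gives the clustering that puts each element with the clique of its covering set and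
leaves the other cliques alone. All its clusters are cliques and `e = a = A`, so the tail is the
single term `i = A`, which is the threshold.

Conversely, let the surprise be at most the threshold. Since the tail is at least `(p - e).choose (m
- e)`, which strictly decreases in `e`, having `e < A` is impossible (`choose_lt_tailCount`). So `e
≥ A`, and each clique has a dominant cluster, missed by only few of its vertices. If these clusters
are distinct for distinct cliques, an edge count forces every element into the dominant cluster of a
set containing it, and in groups of three: an exact cover (`hasExactCover_of_injective`). If two
cliques share a dominant cluster, then about `r ^ 4 / 8` or more intracluster pairs are non-edges.
Then `a` exceeds `m` by order `r ^ 4`, and the last term `a.choose m` alone is at least `2 ^ (r / 16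
* r ^ 3)`. The threshold is at most `(r ^ 6) ^ (2 * r ^ 3)`, because `m - A` is only of order `r ^
3`, so large `r` excludes this case (`choose_lt_tailCount_of_dense`). -/

namespace SurpriseClustering

/-! ### Edges and pairs of a clustering as counts of ordered pairs -/

section Counting

variable {V : Type*}

/-- The subgraph of `G` formed by the edges whose endpoints have the same label. -/
def labelSubgraph {ι : Type*} (G : SimpleGraph V) (f : V → ι) : SimpleGraph V where
  Adj u v := G.Adj u v ∧ f u = f v
  symm := ⟨fun _ _ h => ⟨h.1.symm, h.2.symm⟩⟩
  loopless := ⟨fun _ h => G.loopless.irrefl _ h.1⟩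

instance {ι : Type*} [DecidableEq ι] (G : SimpleGraph V) [DecidableRel G.Adj] (f : V → ι) :
    DecidableRel (labelSubgraph G f).Adj :=
  fun u v => inferInstanceAs (Decidable (G.Adj u v ∧ f u = f v))

lemma labelSubgraph_adj {ι : Type*} (G : SimpleGraph V) (f : V → ι) (u v : V) :
    (labelSubgraph G f).Adj u v ↔ G.Adj u v ∧ f u = f v := Iff.rfl

variable [Fintype V]

/-- Counting ordered pairs turns all four quantities `m`, `p`, `e`, `a` into cardinalities of
filters on `V × V`, which can be compared by inclusion. -/
lemma two_mul_numEdges (G : SimpleGraph V) [DecidableRel G.Adj] :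
    2 * numEdges G = (Finset.univ.filter fun q : V × V => G.Adj q.1 q.2).card := by
  rw [numEdges, ← G.sum_degrees_eq_twice_card_edges, Finset.card_filter, Fintype.sum_prod_type]
  refine Finset.sum_congr rfl fun v _ => ?_
  rw [← Finset.card_filter, ← SimpleGraph.card_neighborFinset_eq_degree,
    SimpleGraph.neighborFinset_eq_filter]

variable [DecidableEq V]

lemma intraEdges_eq_numEdges (G : SimpleGraph V) [DecidableRel G.Adj] (ζ : Clustering V) :
    intraEdges G ζ = numEdges (labelSubgraph G ζ.part) := by
  unfold intraEdges edgesWithin numEdges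
  rw [← Finset.card_biUnion]
  · congr 1
    ext e
    induction e using Sym2.ind with
    | _ u v =>
      simp only [Finset.mem_biUnion, Finset.mem_filter, SimpleGraph.mem_edgeFinset,
        SimpleGraph.mem_edgeSet, Finset.mk_mem_sym2_iff, labelSubgraph_adj]
      constructor
      · rintro ⟨C, hC, h, hu, hv⟩
        exact ⟨h, by rw [ζ.part_eq_of_mem hC hu, ζ.part_eq_of_mem hC hv]⟩
      · rintro ⟨h, he⟩
        exact ⟨ζ.part u, ζ.part_mem.2 (Finset.mem_univ _), h, ζ.mem_part (Finset.mem_univ _),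
          he ▸ ζ.mem_part (Finset.mem_univ _)⟩
  · intro C hC D hD hne
    rw [Function.onFun, Finset.disjoint_left]
    intro e
    induction e using Sym2.ind with
    | _ u v =>
      simp only [Finset.mem_filter, Finset.mk_mem_sym2_iff]
      rintro ⟨-, hu, -⟩ ⟨-, hu', -⟩
      exact hne (ζ.eq_of_mem_parts hC hD hu hu')

lemma two_mul_intraEdges (G : SimpleGraph V) [DecidableRel G.Adj] (ζ : Clustering V) :
    2 * intraEdges G ζ = (Finset.univ.filter fun q : V × V =>
      G.Adj q.1 q.2 ∧ ζ.part q.1 = ζ.part q.2).card := by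
  rw [intraEdges_eq_numEdges, two_mul_numEdges]
  rfl

lemma two_mul_choose_two (n : ℕ) : 2 * n.choose 2 = n * n - n := by
  rw [Nat.choose_two_right, Nat.mul_div_cancel' (Nat.even_mul_pred_self n).two_dvd,
    Nat.mul_sub_one]

lemma two_mul_numPairs :
    2 * numPairs V = (Finset.univ.filter fun q : V × V => q.1 ≠ q.2).card := by
  rw [numPairs, two_mul_choose_two, ← Finset.card_univ, ← Finset.offDiag_card]
  congr 1
  ext q
  simp

lemma two_mul_intraPairs (ζ : Clustering V) :
    2 * intraPairs ζ = (Finset.univ.filter fun q : V × V =>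
      q.1 ≠ q.2 ∧ ζ.part q.1 = ζ.part q.2).card := by
  unfold intraPairs
  simp_rw [Finset.mul_sum, two_mul_choose_two, ← Finset.offDiag_card]
  rw [← Finset.card_biUnion]
  · congr 1
    ext ⟨u, v⟩
    simp only [Finset.mem_biUnion, Finset.mem_filter, Finset.mem_offDiag, Finset.mem_univ,
      true_and]
    constructor
    · rintro ⟨C, hC, hu, hv, h⟩
      exact ⟨h, by rw [ζ.part_eq_of_mem hC hu, ζ.part_eq_of_mem hC hv]⟩
    · rintro ⟨h, he⟩
      exact ⟨ζ.part u, ζ.part_mem.2 (Finset.mem_univ _), ζ.mem_part (Finset.mem_univ _),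
        he ▸ ζ.mem_part (Finset.mem_univ _), h⟩
  · intro C hC D hD hne
    rw [Function.onFun, Finset.disjoint_left]
    rintro ⟨u, v⟩
    simp only [Finset.mem_offDiag]
    rintro ⟨hu, -⟩ ⟨hu', -⟩
    exact hne (ζ.eq_of_mem_parts hC hD hu hu')

lemma intraEdges_le_numEdges (G : SimpleGraph V) [DecidableRel G.Adj] (ζ : Clustering V) :
    intraEdges G ζ ≤ numEdges G := by
  have := Finset.card_le_card (Finset.monotone_filter_right (Finset.univ : Finset (V × V))
    (p := fun q => G.Adj q.1 q.2 ∧ ζ.part q.1 = ζ.part q.2) (q := fun q => G.Adj q.1 q.2)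
    fun _ _ h => h.1)
  rw [← two_mul_intraEdges, ← two_mul_numEdges] at this
  omega

lemma intraEdges_le_intraPairs (G : SimpleGraph V) [DecidableRel G.Adj] (ζ : Clustering V) :
    intraEdges G ζ ≤ intraPairs ζ := by
  have := Finset.card_le_card (Finset.monotone_filter_right (Finset.univ : Finset (V × V))
    (p := fun q => G.Adj q.1 q.2 ∧ ζ.part q.1 = ζ.part q.2)
    (q := fun q => q.1 ≠ q.2 ∧ ζ.part q.1 = ζ.part q.2)
    fun _ _ h => ⟨h.1.ne, h.2⟩)
  rw [← two_mul_intraEdges, ← two_mul_intraPairs] at this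
  omega

lemma intraPairs_le_numPairs (ζ : Clustering V) : intraPairs ζ ≤ numPairs V := by
  have := Finset.card_le_card (Finset.monotone_filter_right (Finset.univ : Finset (V × V))
    (p := fun q => q.1 ≠ q.2 ∧ ζ.part q.1 = ζ.part q.2) (q := fun q => q.1 ≠ q.2)
    fun _ _ h => h.1)
  rw [← two_mul_intraPairs, ← two_mul_numPairs] at this
  omega

lemma numEdges_lt_numPairs (G : SimpleGraph V) [DecidableRel G.Adj] {u v : V} (huv : u ≠ v)
    (h : ¬ G.Adj u v) : numEdges G < numPairs V := by
  have : (Finset.univ.filter fun q : V × V => G.Adj q.1 q.2).card <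
      (Finset.univ.filter fun q : V × V => q.1 ≠ q.2).card := by
    refine Finset.card_lt_card (Finset.ssubset_iff_of_subset ?_ |>.2 ⟨(u, v), ?_, ?_⟩)
    · exact Finset.monotone_filter_right _ fun _ _ h => h.ne
    · simpa using huv
    · simpa using h
  rw [← two_mul_numEdges, ← two_mul_numPairs] at this
  omega

/-- Pairs of vertices in one cluster, one from `A` and one from `B`, that are not joined. -/
lemma intraEdges_add_card_mul_card_le (G : SimpleGraph V) [DecidableRel G.Adj] (ζ : Clustering V)
    (A B : Finset V) (hpart : ∀ a ∈ A, ∀ b ∈ B, ζ.part a = ζ.part b)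
    (hne : ∀ a ∈ A, ∀ b ∈ B, a ≠ b) (hadj : ∀ a ∈ A, ∀ b ∈ B, ¬ G.Adj a b) :
    2 * intraEdges G ζ + A.card * B.card ≤ 2 * intraPairs ζ := by
  rw [two_mul_intraEdges, two_mul_intraPairs, ← Finset.card_product,
    ← Finset.card_union_of_disjoint]
  · refine Finset.card_le_card (Finset.union_subset ?_ ?_)
    · exact Finset.monotone_filter_right _ fun _ _ h => ⟨h.1.ne, h.2⟩
    · rintro ⟨a, b⟩ hq
      rw [Finset.mem_product] at hq
      simpa using ⟨hne a hq.1 b hq.2, hpart a hq.1 b hq.2⟩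
  · rw [Finset.disjoint_right]
    rintro ⟨a, b⟩ hq
    rw [Finset.mem_product] at hq
    simp [hadj a hq.1 b hq.2]

end Counting

/-! ### Bounds for the hypergeometric tail -/

section Tail

/-- The hypergeometric tail without the normalising factor. -/
def tailCount (p m a e : ℕ) : ℕ :=
  ∑ i ∈ Finset.Icc e m, a.choose i * (p - a).choose (m - i)

lemma surprise_eq {V : Type*} [Fintype V] [DecidableEq V] (G : SimpleGraph V)
    [DecidableRel G.Adj] (ζ : Clustering V) :
    surprise G ζ = ((numPairs V).choose (numEdges G) : ℝ)⁻¹ *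
      (tailCount (numPairs V) (numEdges G) (intraPairs ζ) (intraEdges G ζ) : ℕ) := by
  rw [surprise, tailCount, ← Finset.sum_div, div_eq_inv_mul]
  push_cast
  rfl

lemma tailCount_self {p m a : ℕ} (h : a ≤ m) :
    tailCount p m a a = (p - a).choose (m - a) := by
  rw [tailCount, Finset.sum_eq_single a]
  · simp
  · intro i hi hne
    rw [Nat.choose_eq_zero_of_lt (lt_of_le_of_ne (Finset.mem_Icc.1 hi).1 hne.symm), zero_mul]
  · intro hn
    exact absurd (Finset.mem_Icc.2 ⟨le_rfl, h⟩) hn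

lemma choose_le_choose_add_add (a j e : ℕ) : a.choose j ≤ (a + e).choose (j + e) := by
  induction e with
  | zero => exact le_rfl
  | succ e ih =>
    rw [← add_assoc, ← add_assoc, Nat.choose_succ_succ]
    omega

/-- Vandermonde for `p - e = (a - e) + (p - a)`, compared term by term with the tail through `(a -
e).choose j ≤ a.choose (j + e)`. -/
lemma choose_le_tailCount {p m a e : ℕ} (hea : e ≤ a) (hap : a ≤ p) (hem : e ≤ m) :
    (p - e).choose (m - e) ≤ tailCount p m a e := by
  have h1 : p - e = (a - e) + (p - a) := by omega
  rw [h1, Nat.add_choose_eq, Finset.Nat.sum_antidiagonal_eq_sum_range_succ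
    (fun i j => (a - e).choose i * (p - a).choose j), tailCount,
    ← Finset.Ico_succ_right_eq_Icc, Finset.sum_Ico_eq_sum_range]
  have h2 : Order.succ m - e = (m - e).succ := by
    simp only [Nat.succ_eq_succ]
    omega
  rw [h2]
  refine Finset.sum_le_sum fun j _ => ?_
  have h3 : m - (e + j) = m - e - j := by omega
  rw [h3]
  gcongr
  have := choose_le_choose_add_add (a - e) j e
  rwa [Nat.sub_add_cancel hea, add_comm j e] at this

lemma choose_lt_tailCount {p m a e e' : ℕ} (hea : e ≤ a) (hap : a ≤ p) (hee : e < e')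
    (hem : e' ≤ m) (hmp : m < p) : (p - e').choose (m - e') < tailCount p m a e := by
  refine lt_of_lt_of_le ?_ (choose_le_tailCount hea hap (by omega))
  -- One step of Pascal's rule is kept back for strictness: its second summand is positive because
  -- `m < p`.
  have h1 := choose_le_choose_add_add (p - e' + 1) (m - e' + 1) (e' - e - 1)
  have h2 : p - e' + 1 + (e' - e - 1) = p - e := by omega
  have h3 : m - e' + 1 + (e' - e - 1) = m - e := by omega
  rw [h2, h3, Nat.choose_succ_succ] at h1
  have := Nat.choose_pos (show (m - e').succ ≤ p - e' by omega)
  omega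

lemma choose_le_tailCount_of_le {p m a e : ℕ} (hem : e ≤ m) : a.choose m ≤ tailCount p m a e := by
  have := Finset.single_le_sum (f := fun i => a.choose i * (p - a).choose (m - i))
    (fun _ _ => Nat.zero_le _) (Finset.mem_Icc.2 ⟨hem, le_rfl⟩)
  simpa [tailCount] using this

lemma two_pow_le_centralBinom (n : ℕ) : 2 ^ n ≤ n.centralBinom := by
  induction n with
  | zero => simp
  | succ n ih =>
    have h := Nat.succ_mul_centralBinom_succ n
    refine Nat.le_of_mul_le_mul_left (c := n + 1) ?_ (Nat.succ_pos n)
    rw [h, pow_succ]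
    nlinarith

lemma two_pow_le_choose {a m d : ℕ} (hd : d ≤ m) (ha : m + d ≤ a) : 2 ^ d ≤ a.choose m := by
  refine (two_pow_le_centralBinom d).trans ?_
  rw [Nat.centralBinom]
  refine le_trans ?_ (Nat.choose_le_choose m ha)
  rw [Nat.choose_symm_add]
  exact Nat.choose_le_choose d (by omega)

lemma exists_forall_pow_lt_two_pow :
    ∃ c : ℕ, 200 ≤ c ∧ ∀ r : ℕ, c ≤ r → (r ^ 6) ^ (2 * r ^ 3) < 2 ^ (r / 16 * r ^ 3) := by
  have h := (tendsto_pow_const_div_const_pow_of_one_lt 12 (r := (2 : ℝ)) (by norm_num)).eventually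
    (gt_mem_nhds (show (0 : ℝ) < 1 / 32 ^ 12 by positivity))
  obtain ⟨k₀, hk₀⟩ := Filter.eventually_atTop.1 h
  -- With `k = r / 16 ≥ k₀` and `r ≤ 32 * k`, the limit `k ^ 12 / 2 ^ k → 0` gives `r ^ 12 < 2 ^ k`;
  -- raising to the power `r ^ 3` finishes.
  refine ⟨200 + 16 * k₀, by omega, fun r hr => ?_⟩
  have hk := hk₀ (r / 16) (by omega)
  rw [div_lt_div_iff₀ (by positivity) (by positivity), one_mul] at hk
  have hk' : (r / 16) ^ 12 * 32 ^ 12 < 2 ^ (r / 16) := by exact_mod_cast hk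
  have hr' : r ^ 12 < 2 ^ (r / 16) := by
    refine lt_of_le_of_lt ?_ hk'
    rw [← mul_pow]
    exact Nat.pow_le_pow_left (by omega) 12
  calc (r ^ 6) ^ (2 * r ^ 3) = (r ^ 12) ^ (r ^ 3) := by
        rw [← pow_mul, ← pow_mul]
        congr 1
        ring
    _ < (2 ^ (r / 16)) ^ (r ^ 3) := Nat.pow_lt_pow_left hr' (pow_pos (by omega) 3).ne'
    _ = 2 ^ (r / 16 * r ^ 3) := by rw [← pow_mul]

end Tail

/-! ### Label classes on a finite type -/

section EqualLabels

variable {α ι : Type*} [Fintype α] [DecidableEq α] [DecidableEq ι]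

/-- The number of ordered pairs of distinct elements with the same label. -/
def equalLabelPairs (g : α → ι) : ℕ :=
  (Finset.univ.filter fun q : α × α => q.1 ≠ q.2 ∧ g q.1 = g q.2).card

lemma equalLabelPairs_add_card (g : α → ι) :
    equalLabelPairs g + Fintype.card α =
      ∑ a, (Finset.univ.filter fun b => g b = g a).card := by
  rw [equalLabelPairs, Finset.card_filter, Fintype.sum_prod_type, ← Finset.card_univ,
    Finset.card_eq_sum_ones, ← Finset.sum_add_distrib]
  refine Finset.sum_congr rfl fun a _ => ?_
  rw [← Finset.card_filter, ← Finset.card_erase_add_one (s := Finset.univ.filter fun b => g b = g a)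
    (a := a) (by simp)]
  congr 2
  ext b
  simp only [Finset.mem_filter, Finset.mem_univ, true_and, Finset.mem_erase]
  exact ⟨fun h => ⟨h.1.symm, h.2.symm⟩, fun h => ⟨h.1.symm, h.2.symm⟩⟩

lemma equalLabelPairs_const (a : ι) :
    equalLabelPairs (fun _ : α => a) = 2 * (Fintype.card α).choose 2 := by
  have h := equalLabelPairs_add_card (fun _ : α => a)
  simp only [Finset.filter_true, Finset.card_univ, Finset.sum_const, smul_eq_mul] at h
  rw [two_mul_choose_two]
  omega

lemma equalLabelPairs_le (g : α → ι) :
    equalLabelPairs g ≤ 2 * (Fintype.card α).choose 2 := by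
  rw [← equalLabelPairs_const (α := α) ()]
  exact Finset.card_le_card (Finset.monotone_filter_right _ fun _ _ h => ⟨h.1, rfl⟩)

/-- A most frequent label: the elements that do not have it bound the frequency of every other
label and the number of pairs with distinct labels. -/
lemma exists_dominant_label [Nonempty α] (g : α → ι) :
    ∃ (l : ι) (t : ℕ), (Finset.univ.filter fun b => g b = l).card + t = Fintype.card α ∧
      (∀ l' ≠ l, (Finset.univ.filter fun b => g b = l').card ≤ t) ∧
      equalLabelPairs g + Fintype.card α * t ≤ 2 * (Fintype.card α).choose 2 := by
  obtain ⟨a, -, ha⟩ := Finset.exists_max_image (Finset.univ : Finset α)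
    (fun a => (Finset.univ.filter fun b => g b = g a).card) Finset.univ_nonempty
  have hle : (Finset.univ.filter fun b => g b = g a).card ≤ Fintype.card α := Finset.card_le_univ _
  refine ⟨g a, Fintype.card α - (Finset.univ.filter fun b => g b = g a).card, by omega, ?_, ?_⟩
  · intro l' hl'
    have : (Finset.univ.filter fun b => g b = l').card +
        (Finset.univ.filter fun b => g b = g a).card ≤ Fintype.card α := by
      rw [← Finset.card_union_of_disjoint]
      · exact Finset.card_le_univ _
      · rw [Finset.disjoint_filter]
        rintro b - rfl h
        exact hl' h
    omega
  · have h1 := equalLabelPairs_add_card g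
    have h2 := Finset.sum_le_card_nsmul Finset.univ
      (fun a => (Finset.univ.filter fun b => g b = g a).card) _ ha
    rw [Finset.card_univ, smul_eq_mul] at h2
    rw [two_mul_choose_two, Nat.mul_sub]
    have h3 := Nat.mul_le_mul_left (Fintype.card α) hle
    omega

end EqualLabels

/-! ### Edge counts in the constructed graph -/

section Reduction

lemma three_le_card {X : Type*} [Fintype X] {M : Finset (Finset X)} (hM : ∀ S ∈ M, S.card = 3)
    (h : 0 < param M) : 3 ≤ Fintype.card X := by
  obtain ⟨S, hS⟩ := Finset.card_pos.1 (show 0 < M.card by unfold param at h; omega)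
  exact hM S hS ▸ Finset.card_le_univ S

variable {X ι : Type*} [Fintype X] [DecidableEq X] [DecidableEq ι] (M : Finset (Finset X))

/-- The number of edges between element vertices and clique vertices that join equal labels. -/
def equalLabelLinks (f : RedVertex M → ι) : ℕ :=
  ∑ x : X, ∑ S : {S : Finset X // S ∈ M},
    if x ∈ S.1 then (Finset.univ.filter fun i => f (.inr (S, i)) = f (.inl x)).card else 0

/-- The ordered edges split by the types of their endpoints, and element–clique edges occur in both
orders. The labelling is arbitrary so that it can be the clusters, the cover, or a constant, which
counts all edges. -/
lemma card_adj_and_label_eq (f : RedVertex M → ι) :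
    (Finset.univ.filter fun q : RedVertex M × RedVertex M =>
        (redGraph M).Adj q.1 q.2 ∧ f q.1 = f q.2).card =
      (∑ S : {S : Finset X // S ∈ M}, equalLabelPairs fun i => f (.inr (S, i))) +
        2 * equalLabelLinks M f + equalLabelPairs fun x => f (.inl x) := by
  have hxx : (∑ x : X, ∑ y : X,
      if (redGraph M).Adj (.inl x) (.inl y) ∧ f (.inl x) = f (.inl y) then 1 else 0) =
        equalLabelPairs fun x => f (.inl x) := by
    rw [equalLabelPairs, Finset.card_filter, Fintype.sum_prod_type]
    rfl
  have hxc : (∑ x : X, ∑ S : {S : Finset X // S ∈ M}, ∑ i : Fin (param M ^ 2),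
      if (redGraph M).Adj (.inl x) (.inr (S, i)) ∧ f (.inl x) = f (.inr (S, i)) then 1 else 0) =
        equalLabelLinks M f := by
    refine Finset.sum_congr rfl fun x _ => Finset.sum_congr rfl fun S _ => ?_
    by_cases h : x ∈ S.1
    · rw [if_pos h, Finset.card_filter]
      refine Finset.sum_congr rfl fun i _ => if_congr ?_ rfl rfl
      exact ⟨fun h => h.2.symm, fun h' => ⟨h, h'.symm⟩⟩
    · rw [if_neg h]
      exact Finset.sum_eq_zero fun i _ => if_neg fun h' => h h'.1
  have hcx : (∑ S : {S : Finset X // S ∈ M}, ∑ i : Fin (param M ^ 2), ∑ x : X,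
      if (redGraph M).Adj (.inr (S, i)) (.inl x) ∧ f (.inr (S, i)) = f (.inl x) then 1 else 0) =
        equalLabelLinks M f := by
    rw [← hxc]
    refine ((Finset.sum_congr rfl fun S _ => Finset.sum_comm).trans Finset.sum_comm).trans ?_
    refine Finset.sum_congr rfl fun x _ => Finset.sum_congr rfl fun S _ =>
      Finset.sum_congr rfl fun i _ => if_congr ?_ rfl rfl
    rw [(redGraph M).adj_comm, eq_comm (a := f (.inr (S, i)))]
  have hcc : (∑ S : {S : Finset X // S ∈ M}, ∑ i : Fin (param M ^ 2),
      ∑ T : {S : Finset X // S ∈ M}, ∑ j : Fin (param M ^ 2),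
      if (redGraph M).Adj (.inr (S, i)) (.inr (T, j)) ∧ f (.inr (S, i)) = f (.inr (T, j))
        then 1 else 0) =
        ∑ S : {S : Finset X // S ∈ M}, equalLabelPairs fun i => f (.inr (S, i)) := by
    refine Finset.sum_congr rfl fun S _ => ?_
    rw [equalLabelPairs, Finset.card_filter, Fintype.sum_prod_type]
    refine Finset.sum_congr rfl fun i _ => ?_
    rw [Finset.sum_eq_single S]
    · refine Finset.sum_congr rfl fun j _ => if_congr ?_ rfl rfl
      exact ⟨fun h => ⟨h.1.2, h.2⟩, fun h => ⟨⟨rfl, h.1⟩, h.2⟩⟩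
    · intro T _ hT
      exact Finset.sum_eq_zero fun j _ => if_neg fun h => hT h.1.1.symm
    · simp
  rw [Finset.card_filter]
  simp only [Fintype.sum_prod_type, Fintype.sum_sum_type, Finset.sum_add_distrib]
  rw [hxx, hxc, hcx, hcc]
  ring

/-- The number of intracluster pairs of the clusterings that come from exact covers. -/
def coverPairs : ℕ :=
  M.card * (param M ^ 2).choose 2 + Fintype.card X * param M ^ 2 + Fintype.card X

variable {M}

lemma sum_ite_mem_eq (hM : ∀ S ∈ M, S.card = 3) (N : ℕ) :
    (∑ x : X, ∑ S : {S : Finset X // S ∈ M}, if x ∈ S.1 then N else 0) = param M * N := by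
  rw [Finset.sum_comm, param]
  have : ∀ S : {S : Finset X // S ∈ M}, (∑ x : X, if x ∈ S.1 then N else 0) = 3 * N := by
    intro S
    rw [← Finset.sum_filter, Finset.sum_const, Finset.filter_univ_mem, hM S.1 S.2, smul_eq_mul]
  simp [this]
  ring

lemma card_le_param (hM : ∀ S ∈ M, S.card = 3) (hcov : ∀ x : X, ∃ S ∈ M, x ∈ S) :
    Fintype.card X ≤ param M := by
  rw [← mul_one (param M), ← sum_ite_mem_eq hM 1, ← Finset.card_univ, Finset.card_eq_sum_ones]
  refine Finset.sum_le_sum fun x _ => ?_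
  obtain ⟨S, hS, hx⟩ := hcov x
  refine le_trans ?_ (Finset.single_le_sum (fun _ _ => Nat.zero_le _)
    (Finset.mem_univ (⟨S, hS⟩ : {S : Finset X // S ∈ M})))
  simp [hx]

lemma numEdges_redGraph (hM : ∀ S ∈ M, S.card = 3) :
    numEdges (redGraph M) = M.card * (param M ^ 2).choose 2 + param M * param M ^ 2 +
      (Fintype.card X).choose 2 := by
  have h := card_adj_and_label_eq M (fun _ => ())
  simp only [and_true, equalLabelPairs_const, equalLabelLinks, Finset.filter_true,
    Finset.card_univ, Fintype.card_fin, sum_ite_mem_eq hM, ← two_mul_numEdges] at h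
  simp only [Finset.sum_const, Finset.card_univ, Fintype.card_coe, smul_eq_mul] at h
  linarith

lemma equalLabelLinks_le (hM : ∀ S ∈ M, S.card = 3) (f : RedVertex M → ι) :
    equalLabelLinks M f ≤ param M * param M ^ 2 := by
  rw [← sum_ite_mem_eq hM]
  refine Finset.sum_le_sum fun x _ => Finset.sum_le_sum fun S _ => ?_
  split_ifs
  · exact (Finset.card_le_univ _).trans (Fintype.card_fin _).le
  · exact le_rfl

end Reduction

/-! ### Exact covers and clusterings of the constructed graph -/

section ExactCover

lemma numPairs_redVertex {X : Type*} [Fintype X] (M : Finset (Finset X)) :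
    numPairs (RedVertex M) = (M.card * param M ^ 2 + Fintype.card X).choose 2 := by
  simp [numPairs, add_comm]

variable {X : Type*} [Fintype X] [DecidableEq X] {M : Finset (Finset X)}

/-- If every element is labelled by a set containing it and there are enough pairs of equally
labelled elements, then the labels form an exact cover. -/
lemma hasExactCover_of_labelling (hM : ∀ S ∈ M, S.card = 3) (g : X → Finset X)
    (hgM : ∀ x, g x ∈ M) (hg : ∀ x, x ∈ g x)
    (hpairs : 2 * Fintype.card X ≤ equalLabelPairs g) : HasExactCover M := by
  have hsub : ∀ x, (Finset.univ.filter fun y => g y = g x) ⊆ g x := by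
    intro x y hy
    rw [Finset.mem_filter] at hy
    exact hy.2 ▸ hg y
  have hle : ∀ x ∈ Finset.univ, (Finset.univ.filter fun y => g y = g x).card ≤ 3 := fun x _ =>
    hM _ (hgM x) ▸ Finset.card_le_card (hsub x)
  -- Each label class lies in a 3-element set, so `hpairs` forces equality everywhere: every class
  -- is the whole set.
  have hsum : ∑ x, (Finset.univ.filter fun y => g y = g x).card = ∑ _x : X, 3 := by
    refine le_antisymm (Finset.sum_le_sum hle) ?_
    rw [← equalLabelPairs_add_card]
    simp only [Finset.sum_const, Finset.card_univ, smul_eq_mul]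
    omega
  have heq := (Finset.sum_eq_sum_iff_of_le hle).1 hsum
  have hfib : ∀ x, (Finset.univ.filter fun y => g y = g x) = g x := fun x =>
    Finset.eq_of_subset_of_card_le (hsub x) (by rw [heq x (Finset.mem_univ x), hM _ (hgM x)])
  refine ⟨Finset.univ.image g, ?_, fun x => ⟨g x, ⟨?_, hg x⟩, ?_⟩⟩
  · intro S hS
    obtain ⟨x, -, rfl⟩ := Finset.mem_image.1 hS
    exact hgM x
  · exact Finset.mem_image_of_mem g (Finset.mem_univ x)
  · rintro S ⟨hS, hx⟩
    obtain ⟨z, -, rfl⟩ := Finset.mem_image.1 hS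
    rw [← hfib z, Finset.mem_filter] at hx
    exact hx.2.symm

/-- If distinct cliques have distinct dominant labels and there are at least as many edges
joining equal labels as for an exact cover, then there is an exact cover. -/
lemma hasExactCover_of_injective {ι : Type*} [DecidableEq ι] (hM : ∀ S ∈ M, S.card = 3)
    (hX : Fintype.card X ≤ param M) (hr : 2 ≤ param M)
    (f : RedVertex M → ι) (l : {S : Finset X // S ∈ M} → ι) (t : {S : Finset X // S ∈ M} → ℕ)
    (hl : Function.Injective l)
    (ht : ∀ S, ∀ l' ≠ l S, (Finset.univ.filter fun i => f (.inr (S, i)) = l').card ≤ t S)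
    (hpairs : ∀ S, (equalLabelPairs fun i => f (.inr (S, i))) + param M ^ 2 * t S ≤
      2 * (param M ^ 2).choose 2)
    (h : 2 * coverPairs M ≤
      (∑ S : {S : Finset X // S ∈ M}, equalLabelPairs fun i => f (.inr (S, i))) +
        2 * equalLabelLinks M f + equalLabelPairs fun x => f (.inl x)) :
    HasExactCover M := by
  classical
  set N := param M ^ 2 with hN
  set s := Fintype.card X with hs
  set σ := ∑ S, t S with hσ
  let good : X → Prop := fun x => ∃ S : {S : Finset X // S ∈ M}, x ∈ S.1 ∧ l S = f (.inl x)
  -- By injectivity at most one clique is dominated by the label of `x`; it may contribute all `N`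
  -- vertices, any other `S` at most its `t S` exceptions.
  have hlink : ∀ x, (∑ S : {S : Finset X // S ∈ M},
      if x ∈ S.1 then (Finset.univ.filter fun i => f (.inr (S, i)) = f (.inl x)).card else 0) ≤
        (if good x then N else 0) + σ := by
    intro x
    by_cases hx : good x
    · obtain ⟨S, hxS, hS⟩ := hx
      rw [if_pos ⟨S, hxS, hS⟩, hσ, ← Finset.add_sum_erase _ _ (Finset.mem_univ S)]
      refine add_le_add ?_ ?_
      · rw [if_pos hxS]
        exact (Finset.card_le_univ _).trans (Fintype.card_fin _).le
      · refine le_trans (Finset.sum_le_sum fun T hT => ?_)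
          (Finset.sum_le_sum_of_subset (Finset.subset_univ (Finset.univ.erase S)))
        split_ifs
        · exact ht T _ fun hTl => Finset.ne_of_mem_erase hT (hl (hTl.symm.trans hS.symm))
        · exact Nat.zero_le _
    · rw [if_neg hx, zero_add, hσ]
      refine Finset.sum_le_sum fun T _ => ?_
      split_ifs with hxT
      · exact ht T _ fun hTl => hx ⟨T, hxT, hTl.symm⟩
      · exact Nat.zero_le _
  have hlinks : equalLabelLinks M f ≤ (Finset.univ.filter good).card * N + s * σ := by
    refine (Finset.sum_le_sum fun x _ => hlink x).trans ?_
    rw [Finset.sum_add_distrib, ← Finset.sum_filter, Finset.sum_const, Finset.sum_const,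
      Finset.card_univ, smul_eq_mul, smul_eq_mul]
  have hcl : (∑ S : {S : Finset X // S ∈ M}, equalLabelPairs fun i => f (.inr (S, i))) + N * σ ≤
      2 * (M.card * N.choose 2) := by
    rw [hσ, Finset.mul_sum, ← Finset.sum_add_distrib]
    refine (Finset.sum_le_sum fun S _ => hpairs S).trans ?_
    rw [Finset.sum_const, Finset.card_univ, Fintype.card_coe, smul_eq_mul]
    exact le_of_eq (by ring)
  have hxx := equalLabelPairs_le fun x : X => f (.inl x)
  rw [two_mul_choose_two, ← hs] at hxx
  change 2 * (M.card * N.choose 2 + s * N + s) ≤ _ at h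
  -- Exceptional vertices never pay off: in ordered pairs each costs `N` inside the cliques and
  -- gains at most `2 * s` links.
  have hNs : 2 * s ≤ N := by rw [hN]; nlinarith
  have hss : s * s ≤ N := by rw [hN]; nlinarith
  have hσs : 2 * (s * σ) ≤ N * σ := by nlinarith
  -- A bad element loses `2 * N` ordered pairs, more than the `s * s - s ≤ N` pairs among elements
  -- can restore.
  have hgood : ∀ x, good x := by
    by_contra hcon
    push Not at hcon
    obtain ⟨x, hx⟩ := hcon
    have hlt : (Finset.univ.filter good).card < s :=
      Finset.card_lt_univ_of_notMem (x := x) (by simpa using hx)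
    have hmul := Nat.mul_le_mul_right N (Nat.succ_le_of_lt hlt)
    rw [Nat.succ_eq_add_one, add_mul, one_mul] at hmul
    have : 0 < N := by positivity
    omega
  have hcard : (Finset.univ.filter good).card = s := by
    rw [Finset.filter_true_of_mem fun x _ => hgood x, Finset.card_univ]
  rw [hcard] at hlinks
  choose g hxg hlg using hgood
  refine hasExactCover_of_labelling hM (fun x => (g x).1) (fun x => (g x).2) hxg ?_
  have hfg : equalLabelPairs (fun x => (g x).1) = equalLabelPairs fun x : X => f (.inl x) := by
    unfold equalLabelPairs
    congr 1
    refine Finset.filter_congr fun q _ => and_congr_right fun _ => ?_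
    beta_reduce
    rw [← hlg, ← hlg, hl.eq_iff, Subtype.ext_iff]
  rw [hfg]
  omega

/-- A clustering with at least as many intracluster edges as an exact cover gives an exact cover,
unless it has many intracluster pairs that are not joined by an edge. -/
lemma hasExactCover_or_dense (hM : ∀ S ∈ M, S.card = 3) (hX : Fintype.card X ≤ param M)
    (hr : 10 ≤ param M) (ζ : Clustering (RedVertex M))
    (h : coverPairs M ≤ intraEdges (redGraph M) ζ) :
    HasExactCover M ∨
      8 * intraEdges (redGraph M) ζ + param M ^ 4 ≤ 8 * intraPairs ζ := by
  have hcount := two_mul_intraEdges (redGraph M) ζ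
  rw [card_adj_and_label_eq M ζ.part] at hcount
  have hne : Nonempty (Fin (param M ^ 2)) := ⟨⟨0, by positivity⟩⟩
  choose l t hcard ht hpairs using fun S : {S : Finset X // S ∈ M} =>
    exists_dominant_label fun i => ζ.part (.inr (S, i))
  simp only [Fintype.card_fin] at hcard hpairs
  by_cases hl : Function.Injective l
  · exact .inl (hasExactCover_of_injective hM hX (by omega) ζ.part l t hl ht hpairs
      (by omega))
  right
  have hlinks := equalLabelLinks_le hM ζ.part
  have hxx := equalLabelPairs_le fun x : X => ζ.part (.inl x : RedVertex M)
  rw [two_mul_choose_two] at hxx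
  have hcl : (∑ S : {S : Finset X // S ∈ M}, equalLabelPairs fun i => ζ.part (.inr (S, i))) +
      param M ^ 2 * ∑ S, t S ≤ 2 * (M.card * (param M ^ 2).choose 2) := by
    rw [Finset.mul_sum, ← Finset.sum_add_distrib]
    refine (Finset.sum_le_sum fun S _ => hpairs S).trans ?_
    rw [Finset.sum_const, Finset.card_univ, Fintype.card_coe, smul_eq_mul]
    exact le_of_eq (by ring)
  -- Even if every element–clique edge were kept, having `coverPairs M` edges leaves room for few
  -- exceptional vertices.
  have hσ : ∑ S, t S ≤ 2 * param M + 1 := by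
    have hss : Fintype.card X * Fintype.card X ≤ param M ^ 2 := by nlinarith
    unfold coverPairs at h
    refine Nat.le_of_mul_le_mul_left (c := param M ^ 2) ?_ (by positivity)
    have : param M ^ 2 * (2 * param M + 1) = 2 * (param M * param M ^ 2) + param M ^ 2 := by ring
    omega
  have hhalf : ∀ S, param M ^ 2 ≤
      2 * (Finset.univ.filter fun i => ζ.part (.inr (S, i)) = l S).card := by
    intro S
    have h1 := hcard S
    have h2 : t S ≤ ∑ S, t S := Finset.single_le_sum (fun _ _ => Nat.zero_le _) (Finset.mem_univ S)
    have h3 : 10 * param M ≤ param M ^ 2 := by nlinarith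
    omega
  simp only [Function.Injective, not_forall] at hl
  obtain ⟨S, T, hST, hne⟩ := hl
  have hinj : ∀ S : {S : Finset X // S ∈ M}, Function.Injective
      fun i : Fin (param M ^ 2) => (.inr (S, i) : RedVertex M) := fun S i j hij => by
    simpa using hij
  have hdense := intraEdges_add_card_mul_card_le (redGraph M) ζ
    ((Finset.univ.filter fun i => ζ.part (.inr (S, i)) = l S).map ⟨_, hinj S⟩)
    ((Finset.univ.filter fun i => ζ.part (.inr (T, i)) = l T).map ⟨_, hinj T⟩)
    (by
      simp only [Finset.mem_map, Finset.mem_filter, Finset.mem_univ, true_and]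
      rintro _ ⟨i, hi, rfl⟩ _ ⟨j, hj, rfl⟩
      exact hi.trans (hST.trans hj.symm))
    (by
      simp only [Finset.mem_map, Finset.mem_filter, Finset.mem_univ, true_and]
      rintro _ ⟨i, hi, rfl⟩ _ ⟨j, hj, rfl⟩ hij
      exact hne (congrArg Prod.fst (Sum.inr_injective hij)))
    (by
      simp only [Finset.mem_map, Finset.mem_filter, Finset.mem_univ, true_and]
      rintro _ ⟨i, hi, rfl⟩ _ ⟨j, hj, rfl⟩ hij
      exact hne hij.1)
  rw [Finset.card_map, Finset.card_map] at hdense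
  have hmul := Nat.mul_le_mul (hhalf S) (hhalf T)
  have h4 : param M ^ 4 = param M ^ 2 * param M ^ 2 := by ring
  rw [h4]
  linarith

/-- The clustering that joins every set of an exact cover to its clique. -/
lemma exists_clustering_of_hasExactCover (hM : ∀ S ∈ M, S.card = 3) (h : HasExactCover M) :
    ∃ ζ : Clustering (RedVertex M),
      intraEdges (redGraph M) ζ = coverPairs M ∧ intraPairs ζ = coverPairs M := by
  obtain ⟨R, hRM, hR⟩ := h
  choose g hg hguniq using hR
  have hgM : ∀ x, g x ∈ M := fun x => hRM (hg x).1
  have hgiff : ∀ x y, g y = g x ↔ y ∈ g x := fun x y =>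
    ⟨fun h => h ▸ (hg y).2, fun h => (hguniq y (g x) ⟨(hg x).1, h⟩).symm⟩
  let f : RedVertex M → {S : Finset X // S ∈ M} :=
    Sum.elim (fun x => ⟨g x, hgM x⟩) Prod.fst
  obtain ⟨ζ, hpart⟩ : ∃ ζ : Clustering (RedVertex M),
      ∀ u v, ζ.part u = ζ.part v ↔ f u = f v := by
    have : DecidableRel (Setoid.ker f) := fun u v => inferInstanceAs (Decidable (f u = f v))
    refine ⟨Finpartition.ofSetoid (Setoid.ker f), fun u v => ?_⟩
    rw [← Finpartition.mem_part_iff_part_eq_part _ (Finset.mem_univ u) (Finset.mem_univ v),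
      Finpartition.mem_part_ofSetoid_iff_rel]
    exact Setoid.ker_def.trans eq_comm
  have hedges : intraEdges (redGraph M) ζ = coverPairs M := by
    have hcount := two_mul_intraEdges (redGraph M) ζ
    rw [Finset.filter_congr fun q _ => and_congr_right fun _ => hpart q.1 q.2,
      card_adj_and_label_eq M f] at hcount
    have hlinks : equalLabelLinks M f = Fintype.card X * param M ^ 2 := by
      have : ∀ x : X, (∑ S : {S : Finset X // S ∈ M}, if x ∈ S.1 then
          (Finset.univ.filter fun i => f (.inr (S, i)) = f (.inl x)).card else 0) =
            param M ^ 2 := by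
        intro x
        rw [Finset.sum_eq_single ⟨g x, hgM x⟩]
        · simp [f, (hg x).2]
        · intro S _ hS
          split_ifs
          · simp [f, hS]
          · rfl
        · simp
      rw [equalLabelLinks, Finset.sum_congr rfl fun x _ => this x]
      simp
    have hxx : (equalLabelPairs fun x => f (.inl x)) = 2 * Fintype.card X := by
      have h1 := equalLabelPairs_add_card fun x => f (.inl x)
      have h2 : ∀ x, (Finset.univ.filter fun y => f (.inl y) = f (.inl x)).card = 3 := by
        intro x
        rw [← hM _ (hgM x)]
        congr 1
        ext y
        simp [f, hgiff]
      simp only [h2, Finset.sum_const, Finset.card_univ, smul_eq_mul] at h1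
      omega
    have hcl : ∀ S, (equalLabelPairs fun i : Fin (param M ^ 2) => f (.inr (S, i))) =
        2 * (param M ^ 2).choose 2 := fun S => by
      simpa [f] using equalLabelPairs_const (α := Fin (param M ^ 2)) S
    simp only [hlinks, hxx, hcl, Finset.sum_const, Finset.card_univ, Fintype.card_coe,
      smul_eq_mul] at hcount
    unfold coverPairs
    linarith
  refine ⟨ζ, hedges, ?_⟩
  rw [← hedges]
  -- It remains to see that every cluster is a clique: distinct vertices with equal labels are
  -- adjacent.
  refine Nat.eq_of_mul_eq_mul_left two_pos ?_
  rw [two_mul_intraEdges, two_mul_intraPairs]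
  congr 1
  refine Finset.filter_congr fun q _ => and_congr_left fun hq => ?_
  rw [hpart] at hq
  refine ⟨fun hne => ?_, fun h => h.ne⟩
  obtain ⟨x | ⟨S, i⟩, y | ⟨T, j⟩⟩ := q
  · exact fun h => hne (congrArg Sum.inl h)
  · show x ∈ T.1
    have : (⟨g x, hgM x⟩ : {S : Finset X // S ∈ M}) = T := hq
    exact this ▸ (hg x).2
  · show y ∈ S.1
    have : S = (⟨g y, hgM y⟩ : {S : Finset X // S ∈ M}) := hq
    exact this ▸ (hg y).2
  · have hST : S = T := hq
    subst hST
    exact ⟨rfl, fun h => hne (by rw [h])⟩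

lemma threshold_eq (hM : ∀ S ∈ M, S.card = 3) (hX : Fintype.card X ≤ param M) :
    threshold M = ((numPairs (RedVertex M)).choose (numEdges (redGraph M)) : ℝ)⁻¹ *
      ((numPairs (RedVertex M) - coverPairs M).choose
        (numEdges (redGraph M) - coverPairs M) : ℕ) := by
  have h1 : (M.card * param M ^ 2 + Fintype.card X).choose 2 - M.card * (param M ^ 2).choose 2
      - Fintype.card X * param M ^ 2 - Fintype.card X = numPairs (RedVertex M) - coverPairs M := by
    rw [numPairs_redVertex, coverPairs, Nat.sub_sub, Nat.sub_sub, add_assoc]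
  have h2 : (3 * M.card - Fintype.card X) * param M ^ 2 + (Fintype.card X).choose 2
      - Fintype.card X = numEdges (redGraph M) - coverPairs M := by
    rw [numEdges_redGraph hM, coverPairs, Nat.sub_mul]
    have := Nat.mul_le_mul_right (param M ^ 2) hX
    change param M * _ - _ + _ - _ = _
    omega
  rw [threshold, h1, h2]

/-- Three elements are needed for `(Fintype.card X).choose 2 ≥ Fintype.card X`. -/
lemma coverPairs_le_numEdges (hM : ∀ S ∈ M, S.card = 3) (hX : Fintype.card X ≤ param M)
    (hX3 : 3 ≤ Fintype.card X) : coverPairs M ≤ numEdges (redGraph M) := by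
  rw [numEdges_redGraph hM, coverPairs]
  have h1 := Nat.mul_le_mul_right (param M ^ 2) hX
  have h2 := two_mul_choose_two (Fintype.card X)
  have h3 : 3 * Fintype.card X ≤ Fintype.card X * Fintype.card X := Nat.mul_le_mul_right _ hX3
  omega

/-- A clustering with many intracluster pairs that are not joined has a large surprise. -/
lemma choose_lt_tailCount_of_dense (hM : ∀ S ∈ M, S.card = 3) (hX : Fintype.card X ≤ param M)
    (hX3 : 3 ≤ Fintype.card X) (hr : 200 ≤ param M)
    (hpow : (param M ^ 6) ^ (2 * param M ^ 3) < 2 ^ (param M / 16 * param M ^ 3)) {a e : ℕ}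
    (he : coverPairs M ≤ e) (hem : e ≤ numEdges (redGraph M)) (ha : 8 * e + param M ^ 4 ≤ 8 * a) :
    (numPairs (RedVertex M) - coverPairs M).choose (numEdges (redGraph M) - coverPairs M) <
      tailCount (numPairs (RedVertex M)) (numEdges (redGraph M)) a e := by
  have hm := numEdges_redGraph hM
  have hcov := coverPairs_le_numEdges hM hX hX3
  set m := numEdges (redGraph M)
  set r := param M with hrdef
  have hμ : r = 3 * M.card := rfl
  have hchoose : (Fintype.card X).choose 2 ≤ r ^ 2 := by
    have h2 := two_mul_choose_two (Fintype.card X)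
    have : Fintype.card X * Fintype.card X ≤ r ^ 2 := by nlinarith
    omega
  have h23 : 200 * r ^ 2 ≤ r ^ 3 := by nlinarith [sq_nonneg r]
  have h34 : 200 * r ^ 3 ≤ r ^ 4 := by
    calc 200 * r ^ 3 ≤ r * r ^ 3 := Nat.mul_le_mul_right _ hr
      _ = r ^ 4 := by ring
  have hr3 : r * r ^ 2 = r ^ 3 := by ring
  have hK : m - coverPairs M ≤ 2 * r ^ 3 := by
    rw [hm, coverPairs, ← hrdef]
    omega
  have hp : numPairs (RedVertex M) ≤ r ^ 6 := by
    rw [numPairs_redVertex]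
    refine (Nat.choose_le_pow _ 2).trans ?_
    rw [show r ^ 6 = (r ^ 3) ^ 2 by ring]
    refine Nat.pow_le_pow_left ?_ 2
    have : 3 * (M.card * r ^ 2) = r ^ 3 := by rw [← mul_assoc, ← hμ, hr3]
    nlinarith
  have hdm : r / 16 * r ^ 3 ≤ m := by
    have h1 : 2 * (r ^ 2).choose 2 = r ^ 2 * r ^ 2 - r ^ 2 := two_mul_choose_two _
    have h2 : (r ^ 2).choose 2 ≤ M.card * (r ^ 2).choose 2 :=
      Nat.le_mul_of_pos_left _ (by omega)
    have h3 : r / 16 * r ^ 3 * 16 ≤ r ^ 4 := by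
      calc r / 16 * r ^ 3 * 16 = (r / 16 * 16) * r ^ 3 := by ring
        _ ≤ r * r ^ 3 := Nat.mul_le_mul_right _ (Nat.div_mul_le_self r 16)
        _ = r ^ 4 := by ring
    have h4 : r ^ 2 * r ^ 2 = r ^ 4 := by ring
    omega
  -- Of the surplus `r ^ 4 / 8` of `a` over `e`, at most `2 * r ^ 3 ≤ r ^ 4 / 100` goes into `m -
  -- e`; more than `r ^ 4 / 16` remains.
  have hda : m + r / 16 * r ^ 3 ≤ a := by
    have h3 : r / 16 * r ^ 3 * 16 ≤ r ^ 4 := by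
      calc r / 16 * r ^ 3 * 16 = (r / 16 * 16) * r ^ 3 := by ring
        _ ≤ r * r ^ 3 := Nat.mul_le_mul_right _ (Nat.div_mul_le_self r 16)
        _ = r ^ 4 := by ring
    omega
  calc _ ≤ (numPairs (RedVertex M) - coverPairs M) ^ (m - coverPairs M) := Nat.choose_le_pow _ _
    _ ≤ (r ^ 6) ^ (m - coverPairs M) := Nat.pow_le_pow_left (by omega) _
    _ ≤ (r ^ 6) ^ (2 * r ^ 3) := Nat.pow_le_pow_right (by positivity) hK
    _ < 2 ^ (r / 16 * r ^ 3) := hpow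
    _ ≤ a.choose m := two_pow_le_choose hdm hda
    _ ≤ _ := choose_le_tailCount_of_le hem

end ExactCover

end SurpriseClustering

/-! ### The equivalence -/

open SurpriseClustering

theorem theorem11 :
    ∃ c : ℕ, 0 < c ∧
      ∀ (X : Type*) [Fintype X] [DecidableEq X] (M : Finset (Finset X)),
        (∀ S ∈ M, S.card = 3) →
        (∀ x : X, ∃ S ∈ M, x ∈ S) →
        c ≤ SurpriseClustering.param M →
        (SurpriseClustering.HasExactCover M ↔
          ∃ ζ : SurpriseClustering.Clustering (SurpriseClustering.RedVertex M),
            SurpriseClustering.surprise (SurpriseClustering.redGraph M) ζ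
              ≤ SurpriseClustering.threshold M) := by
  obtain ⟨c, hc, hpow⟩ := exists_forall_pow_lt_two_pow
  refine ⟨c, by omega, fun X _ _ M hM hcov hr => ?_⟩
  have hX := card_le_param hM hcov
  have hX3 := three_le_card hM (by omega)
  have hcm := coverPairs_le_numEdges hM hX hX3
  rw [threshold_eq hM hX]
  constructor
  · intro h
    obtain ⟨ζ, he, hp⟩ := exists_clustering_of_hasExactCover hM h
    refine ⟨ζ, ?_⟩
    rw [surprise_eq, he, hp, tailCount_self hcm]
  · rintro ⟨ζ, hζ⟩
    -- Vertices of two different cliques are not adjacent, so the graph is not complete.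
    have hmp : numEdges (redGraph M) < numPairs (RedVertex M) := by
      obtain ⟨S, hS, T, hT, hne⟩ := Finset.one_lt_card.1
        (show 1 < M.card by unfold param at hr; omega)
      have hpos : 0 < param M ^ 2 := pow_pos (by omega) 2
      refine numEdges_lt_numPairs _ (u := .inr (⟨S, hS⟩, ⟨0, hpos⟩))
        (v := .inr (⟨T, hT⟩, ⟨0, hpos⟩)) (by simpa using hne) fun h => ?_
      exact hne (congrArg Subtype.val h.1)
    have hpm : (0 : ℝ) < ((numPairs (RedVertex M)).choose (numEdges (redGraph M)) : ℝ)⁻¹ :=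
      inv_pos.2 (by exact_mod_cast Nat.choose_pos hmp.le)
    rw [surprise_eq, mul_le_mul_iff_right₀ hpm, Nat.cast_le] at hζ
    rcases lt_or_ge (intraEdges (redGraph M) ζ) (coverPairs M) with hlt | hge
    · exact absurd hζ (not_le.2 (choose_lt_tailCount (intraEdges_le_intraPairs _ ζ)
        (intraPairs_le_numPairs ζ) hlt hcm hmp))
    · rcases hasExactCover_or_dense hM hX (by omega) ζ hge with h | h
      · exact h
      · exact absurd hζ (not_le.2 (choose_lt_tailCount_of_dense hM hX hX3 (by omega)
          (hpow _ hr) hge (intraEdges_le_numEdges _ ζ) h))
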